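/- Let $\mathbb T=\mathbb R/2\pi\mathbb Z$ and let $H^{3/\log}(\mathbb T;\mathbb R^2)$ be the space of $f\in L^2(\mathbb T;\mathbb R^2)$ with $$\sum_{n\in\mathbb Z}\frac{|n|^{6}}{\log^2(|n|+e)}\,|\hat f(n)|^2<\infty ,$$ normed by the square root of the sum of $\|f\|_{L^2}^2$ and this series; its elements are identified with their continuous (in fact $C^2$) representatives. For a $2\pi$-periodic curve $X:\mathbb R\to\mathbb R^2$ in this space put, for $\gamma,\eta\in[-\pi,\pi]$, $$F(X)(\gamma,\eta)=\frac{|\eta|}{|X(\gamma)-X(\gamma-\eta)|}\quad(\eta\neq0),\qquad F(X)(\gamma,0)=\frac1{|\partial_\gamma X(\gamma)|},$$ with value $+\infty$ where a denominator vanishes. The curve satisfies the arc-chord condition if $F(X)\in L^\infty([-\pi,\pi]^2)$. Let $T>0$ and let $x,y\in C([0,T];H^{3/\log}(\mathbb T;\mathbb R^2))$ be two solutions of the contour equation $$x_t(\gamma,t)=\int_{-\pi}^{\pi}\frac{\partial_\gamma x(\gamma,t)-\partial_\gamma x(\gamma-\eta,t)}{|x(\gamma,t)-x(\gamma-\eta,t)|}\,d\eta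 ,\qquad \gamma\in\mathbb R,\ 0<t<T,$$ such that $x(\cdot,t)$ and $y(\cdot,t)$ satisfy the arc-chord condition for every $t\in[0,T]$ (no constant-speed parameterization is assumed). If $x(\cdot,0)=y(\cdot,0)$, then $x(\cdot,t)=y(\cdot,t)$ for every $t\in[0,T]$. -/

import Mathlib

open Real Set Filter Topology MeasureTheory
open scoped ENNReal

noncomputable section

namespace SQGContour

/-- The Euclidean plane. A closed curve is a `2π`-periodic map `ℝ → Plane`. -/
abbrev Plane : Type := EuclideanSpace ℝ (Fin 2)

/-- The `n`-th Fourier coefficient `(2π)⁻¹ ∫_{-π}^{π} X_i(γ) e^{-inγ} dγ` of the `i`-th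
coordinate of `X`. -/
def coeff (X : ℝ → Plane) (i : Fin 2) (n : ℤ) : ℂ :=
  fourierCoeffOn (neg_lt_self Real.pi_pos) (fun γ : ℝ => ((X γ i : ℝ) : ℂ)) n

/-- `∑_n |n|^{2k} / log²(|n| + e) · |X̂(n)|²`, with values in `[0, ∞]`. -/
def hLogSeminormSq (k : ℕ) (X : ℝ → Plane) : ℝ≥0∞ :=
  ∑ i : Fin 2, ∑' n : ℤ,
    ENNReal.ofReal (|(n : ℝ)| ^ (2 * k) / Real.log (|(n : ℝ)| + Real.exp 1) ^ 2)
      * ‖coeff X i n‖ₑ ^ 2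

/-- The square of the full norm: the square of the `L²(𝕋)` norm plus the weighted sum
(which alone does not see the mean of `X`). -/
def hLogNormSq (k : ℕ) (X : ℝ → Plane) : ℝ≥0∞ :=
  (∫⁻ γ in Ioc (-π) π, ‖X γ‖ₑ ^ 2) + hLogSeminormSq k X

/-- Membership in `H^{k/log}(𝕋; ℝ²)`. -/
def MemHLog (k : ℕ) (X : ℝ → Plane) : Prop :=
  Function.Periodic X (2 * π) ∧ MemLp X 2 (volume.restrict (Ioc (-π) π)) ∧
    hLogSeminormSq k X < ∞

/-- `x ∈ C([0,T]; H^{k/log}(𝕋; ℝ²))`, where `x t` is the curve at time `t`. -/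
def ContinuousInHLog (k : ℕ) (T : ℝ) (x : ℝ → ℝ → Plane) : Prop :=
  (∀ t ∈ Icc 0 T, MemHLog k (x t)) ∧
    ∀ t₀ ∈ Icc 0 T,
      Tendsto (fun t => hLogNormSq k (x t - x t₀)) (𝓝[Icc 0 T] t₀) (𝓝 0)

/-- The arc-chord quantity `F(X)(γ, η) = |η| / |X(γ) - X(γ - η)|` for `η ≠ 0` and
`F(X)(γ, 0) = 1 / |∂X(γ)|`. It takes the value `∞` where the denominator vanishes. -/
def arcChord (X : ℝ → Plane) (γ η : ℝ) : ℝ≥0∞ :=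
  if η = 0 then ‖deriv X γ‖ₑ⁻¹ else ‖η‖ₑ / ‖X γ - X (γ - η)‖ₑ

/-- The arc-chord condition: `F(X) ∈ L^∞([-π,π] × [-π,π])`. -/
def ArcChordCondition (X : ℝ → Plane) : Prop :=
  essSup (fun p : ℝ × ℝ => arcChord X p.1 p.2)
    (volume.restrict (Icc (-π) π ×ˢ Icc (-π) π)) < ∞

/-- The right-hand side of the contour equation,
`∫_𝕋 (∂X(γ) - ∂X(γ - η)) / |X(γ) - X(γ - η)| dη`. -/
def velocity (X : ℝ → Plane) (γ : ℝ) : Plane :=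
  ∫ η in (-π)..π, ‖X γ - X (γ - η)‖⁻¹ • (deriv X γ - deriv X (γ - η))

/-- A solution on `[0,T]` of the contour equation in `C([0,T]; H^{3/log})` that satisfies the
arc-chord condition at every time. An element of `H^{3/log}` has a unique continuous
representative (which is `C²`); `x t` is that representative. -/
structure IsSolution (T : ℝ) (x : ℝ → ℝ → Plane) : Prop where
  continuous_curve : ∀ t ∈ Icc 0 T, Continuous (x t)
  continuousInHLog : ContinuousInHLog 3 T x
  arcChord : ∀ t ∈ Icc 0 T, ArcChordCondition (x t)
  equation : ∀ t ∈ Ioo 0 T, ∀ γ : ℝ, HasDerivAt (fun s => x s γ) (velocity (x t) γ) t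

end SQGContour

end

namespace SQGContour

/-! The proof is an `L²` estimate for `z = x - y`, in which no derivative of `z` is lost, closed by
a logarithmic Gronwall argument.

The weight `|n|³ / log` dominates `n²` up to a square-summable factor, so `H^{3/log}` embeds in
`C^{1,1}`. By compactness of `[0, T]`, one constant `M` then bounds the `C^{1,1}` norms and the
arc-chord quantities of both solutions at all times (`IsSolution.exists_admissible`).

Let `a`, `b` be the chords `X γ - X (γ - η)`, `Y γ - Y (γ - η)` and let a prime denote `∂_γ`. Since
the kernel is antisymmetric, the time derivative of half the energy is `∫₀^π ∫ ⟨a - b, a'/|a| -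
b'/|b|⟩ dγ dη`. By `inner_sub_kernel_le` the integrand is at most `½ ∂_γ (|a - b|² / |a|)`, which
integrates to zero over a period, plus `(3/2) M³ |a - b|² / η`.

The remaining integral over `η` diverges logarithmically if `|a - b|` is controlled by `z` in `L²`
alone. Near `η = 0` the Lipschitz bound `|a - b| ≤ 2 M η` helps: for every `ε > 0`, `E' ≤ K log((π +
ε)/ε) (E + ε²)` with `K` independent of `ε`. Over a time at most `1/K` Gronwall's factor is at most
`(π + ε)/ε`, so `E ≤ ε (π + ε)`, and `ε → 0` gives `E = 0`. Steps of length `1/K` cover `[0, T]`. -/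

/-! ### Fourier series and the embedding of `H^{3/log}` in `C^{1,1}` -/

theorem summable_sq_log_div_abs :
    Summable (fun n : ℤ => (Real.log (|(n : ℝ)| + Real.exp 1) / |(n : ℝ)|) ^ 2) := by
  have hs : Summable (fun n : ℤ => 32 * |(n : ℝ)| ^ (-(3 / 2 : ℝ))) :=
    (Real.summable_abs_int_rpow (by norm_num)).mul_left _
  refine Summable.of_nonneg_of_le (fun n => sq_nonneg _) (fun n => ?_) hs
  rcases eq_or_ne n 0 with rfl | hn
  · simp
  have h1 : (1 : ℝ) ≤ |(n : ℝ)| := by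
    exact_mod_cast Int.one_le_abs hn
  set a := |(n : ℝ)|
  have ha : 0 < a := by linarith
  have he : Real.exp 1 < 3 := Real.exp_one_lt_three
  have he0 := Real.exp_pos 1
  have hle : a + Real.exp 1 ≤ 4 * a := by linarith
  have hlog0 : 0 ≤ Real.log (a + Real.exp 1) := Real.log_nonneg (by linarith)
  -- Any exponent below `1/2` would do; `1/4` makes the squared quotient `O(|n|^(-3/2))`, and `32 =
  -- 4² · 4^(1/2)`.
  have hlog : Real.log (a + Real.exp 1) ≤ (4 * a) ^ (1 / 4 : ℝ) / (1 / 4) :=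
    (Real.log_le_log (by linarith) hle).trans (Real.log_le_rpow_div (by linarith) (by norm_num))
  have h4 : ((4 * a) ^ (1 / 4 : ℝ)) ^ 2 = 2 * a ^ (1 / 2 : ℝ) := by
    rw [← Real.rpow_natCast, ← Real.rpow_mul (by linarith), Real.mul_rpow (by norm_num) ha.le]
    norm_num
  have h3 : a ^ (-(3 / 2 : ℝ)) = a ^ (1 / 2 : ℝ) / a ^ 2 := by
    rw [← Real.rpow_natCast, ← Real.rpow_sub ha]; norm_num
  rw [div_pow, h3, ← mul_div_assoc]
  gcongr
  calc Real.log (a + Real.exp 1) ^ 2 ≤ ((4 * a) ^ (1 / 4 : ℝ) / (1 / 4)) ^ 2 := by gcongr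
    _ = 32 * a ^ (1 / 2 : ℝ) := by rw [div_pow, h4]; ring

/-- The constant of the embedding `H^{3/log} ⊂ C^{1,1}` at the level of Fourier coefficients. -/
noncomputable def embeddingConst : ℝ :=
  1 + √(∑' n : ℤ, (Real.log (|(n : ℝ)| + Real.exp 1) / |(n : ℝ)|) ^ 2)

theorem one_le_embeddingConst : 1 ≤ embeddingConst := by
  unfold embeddingConst; linarith [Real.sqrt_nonneg
    (∑' n : ℤ, (Real.log (|(n : ℝ)| + Real.exp 1) / |(n : ℝ)|) ^ 2)]

/-- Cauchy–Schwarz for the splitting `n² |c n| = (log / |n|) · (|n|³ / log · |c n|)`. -/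
theorem summable_sq_mul_norm {c : ℤ → ℂ} {r : ℝ} (hr : 0 ≤ r)
    (h : ∑' n : ℤ, ENNReal.ofReal (|(n : ℝ)| ^ 6 / Real.log (|(n : ℝ)| + Real.exp 1) ^ 2)
      * ‖c n‖ₑ ^ 2 ≤ ENNReal.ofReal (r ^ 2)) :
    Summable (fun n : ℤ => (n : ℝ) ^ 2 * ‖c n‖) ∧
      ∑' n : ℤ, (n : ℝ) ^ 2 * ‖c n‖ ≤ embeddingConst * r := by
  set l : ℤ → ℝ := fun n => Real.log (|(n : ℝ)| + Real.exp 1) with hl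
  have hl0 : ∀ n, 0 < l n := fun n => Real.log_pos (by
    have := Real.add_one_le_exp (1 : ℝ)
    have := abs_nonneg (n : ℝ)
    linarith)
  set f : ℤ → ℝ := fun n => l n / |(n : ℝ)|
  set g : ℤ → ℝ := fun n => |(n : ℝ)| ^ 3 / l n * ‖c n‖
  have hfg : ∀ n : ℤ, (n : ℝ) ^ 2 * ‖c n‖ = f n * g n := by
    intro n
    rcases eq_or_ne n 0 with rfl | hn
    · simp [g]
    have : |(n : ℝ)| ≠ 0 := by simpa using hn
    simp only [f, g]
    rw [← sq_abs]
    field_simp [(hl0 n).ne']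
  have hg : ∀ s : Finset ℤ, ∑ n ∈ s, g n ^ 2 ≤ r ^ 2 := by
    intro s
    have h1 : ∀ n : ℤ, ENNReal.ofReal (g n ^ 2) =
        ENNReal.ofReal (|(n : ℝ)| ^ 6 / Real.log (|(n : ℝ)| + Real.exp 1) ^ 2) * ‖c n‖ₑ ^ 2 := by
      intro n
      rw [← ofReal_norm, ← ENNReal.ofReal_pow (norm_nonneg _),
        ← ENNReal.ofReal_mul (by positivity)]
      congr 1
      simp only [g, hl]
      ring
    have h2 : ENNReal.ofReal (∑ n ∈ s, g n ^ 2) ≤ ENNReal.ofReal (r ^ 2) := by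
      rw [ENNReal.ofReal_sum_of_nonneg (fun n _ => sq_nonneg _)]
      simp_rw [h1]
      exact (ENNReal.sum_le_tsum s).trans h
    exact (ENNReal.ofReal_le_ofReal_iff (sq_nonneg r)).1 h2
  have hf : ∀ s : Finset ℤ, ∑ n ∈ s, f n ^ 2 ≤ ∑' n, f n ^ 2 := fun s =>
    summable_sq_log_div_abs.sum_le_tsum s (fun n _ => sq_nonneg _)
  have key : ∀ s : Finset ℤ, ∑ n ∈ s, (n : ℝ) ^ 2 * ‖c n‖ ≤ embeddingConst * r := by
    intro s
    simp_rw [hfg]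
    calc ∑ n ∈ s, f n * g n ≤ √(∑ n ∈ s, f n ^ 2) * √(∑ n ∈ s, g n ^ 2) :=
          Real.sum_mul_le_sqrt_mul_sqrt s f g
      _ ≤ √(∑' n, f n ^ 2) * √(r ^ 2) := by
          gcongr
          · exact hf s
          · exact hg s
      _ ≤ embeddingConst * r := by
          rw [Real.sqrt_sq hr]
          gcongr
          unfold embeddingConst
          linarith
  have hnn : ∀ n : ℤ, 0 ≤ (n : ℝ) ^ 2 * ‖c n‖ := fun n => by positivity
  exact ⟨summable_of_sum_le hnn key, Real.tsum_le_of_sum_le hnn key⟩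

theorem hasSum_fourier_of_summable {f : ℝ → ℂ} (hf : Continuous f)
    (hper : Function.Periodic f (2 * π))
    (hs : Summable (fourierCoeffOn (neg_lt_self Real.pi_pos) f)) (γ : ℝ) :
    HasSum (fun n : ℤ => fourierCoeffOn (neg_lt_self Real.pi_pos) f n *
      Complex.exp (Complex.I * n * γ)) (f γ) := by
  have hT : π - -π = 2 * π := by ring
  have : Fact (0 < π - -π) := ⟨by linarith [Real.pi_pos]⟩
  have hper' : Function.Periodic f (π - -π) := by rwa [hT]
  -- The coefficients are defined through `liftIoc`, whereas evaluation at an arbitrary real needs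
  -- the periodic lift.
  have hlift : AddCircle.liftIoc (π - -π) (-π) f = hper'.lift := by
    ext x
    obtain ⟨y, hy, rfl⟩ := AddCircle.coe_image_Ioc_eq (π - -π) (-π) ▸ mem_univ x
    rw [AddCircle.liftIoc_coe_apply hy, Function.Periodic.lift_coe]
  have hc : Continuous (AddCircle.liftIoc (π - -π) (-π) f) :=
    AddCircle.liftIoc_continuous (hper' _).symm hf.continuousOn
  let F : C(AddCircle (π - -π), ℂ) := ⟨_, hc⟩
  have h := has_pointwise_sum_fourier_series_of_summable (f := F) hs (γ : AddCircle (π - -π))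
  have hF : F (γ : AddCircle (π - -π)) = f γ := by
    change AddCircle.liftIoc (π - -π) (-π) f _ = _
    rw [hlift, Function.Periodic.lift_coe]
  rw [hF] at h
  convert h using 2 with n
  rw [smul_eq_mul, fourier_coe_apply]
  have : (π : ℂ) ≠ 0 := by exact_mod_cast Real.pi_ne_zero
  congr 2
  push_cast
  field_simp
  ring

theorem norm_exp_I_int_mul (n : ℤ) (γ : ℝ) : ‖Complex.exp (Complex.I * n * γ)‖ = 1 := by
  have := Complex.norm_exp_ofReal_mul_I (n * γ)
  rw [← this]; push_cast; ring_nf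

/-- The series is differentiated termwise; the factor `n²` pays for one derivative and for its
Lipschitz constant. The weighted sum does not see the mean, hence the separate hypothesis `h0` and
the factor `2` in the sup bound. -/
theorem exists_deriv_of_fourier_summable {f : ℝ → ℂ} (hf : Continuous f)
    (hper : Function.Periodic f (2 * π)) {B : ℝ}
    (hs : Summable (fun n : ℤ => (n : ℝ) ^ 2 * ‖fourierCoeffOn (neg_lt_self Real.pi_pos) f n‖))
    (hB : ∑' n : ℤ, (n : ℝ) ^ 2 * ‖fourierCoeffOn (neg_lt_self Real.pi_pos) f n‖ ≤ B)
    (h0 : ‖fourierCoeffOn (neg_lt_self Real.pi_pos) f 0‖ ≤ B) :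
    ∃ g : ℝ → ℂ, (∀ γ, HasDerivAt f (g γ) γ) ∧ (∀ γ, ‖f γ‖ ≤ 2 * B) ∧ (∀ γ, ‖g γ‖ ≤ B) ∧
      ∀ γ δ, ‖g γ - g δ‖ ≤ B * |γ - δ| := by
  set c := fourierCoeffOn (neg_lt_self Real.pi_pos) f with hc
  have hn1 : ∀ n : ℤ, |(n : ℝ)| ≤ (n : ℝ) ^ 2 := by
    intro n
    rcases eq_or_ne n 0 with rfl | hn
    · simp
    have h1 : (1 : ℝ) ≤ |(n : ℝ)| := by exact_mod_cast Int.one_le_abs hn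
    rw [← sq_abs]; nlinarith
  have hs' : Summable (fun n : ℤ => (n : ℝ) ^ 2 * ‖c n‖ + (if n = 0 then ‖c 0‖ else 0)) :=
    hs.add (hasSum_ite_eq 0 ‖c 0‖).summable
  have hle : ∀ n : ℤ, ‖c n‖ ≤ (n : ℝ) ^ 2 * ‖c n‖ + (if n = 0 then ‖c 0‖ else 0) := by
    intro n
    rcases eq_or_ne n 0 with rfl | hn
    · simp
    have h1 : (1 : ℝ) ≤ |(n : ℝ)| := by exact_mod_cast Int.one_le_abs hn
    rw [if_neg hn, add_zero]
    nlinarith [hn1 n, norm_nonneg (c n)]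
  have hsc : Summable (fun n => ‖c n‖) := hs'.of_nonneg_of_le (fun _ => norm_nonneg _) hle
  have hrep := hasSum_fourier_of_summable hf hper hsc.of_norm
  have hfe : f = fun γ : ℝ => ∑' n : ℤ, c n * Complex.exp (Complex.I * n * γ) :=
    funext fun γ => (hrep γ).tsum_eq.symm
  set g : ℝ → ℂ := fun γ => ∑' n : ℤ, c n * (Complex.exp (Complex.I * n * γ) * (Complex.I * n))
  have hexp : ∀ (n : ℤ) (γ : ℝ), HasDerivAt (fun γ : ℝ => Complex.exp (Complex.I * n * γ))
      (Complex.exp (Complex.I * n * γ) * (Complex.I * n)) γ := by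
    intro n γ
    have h := ((Complex.ofRealCLM.hasDerivAt (x := γ)).const_mul (Complex.I * n)).cexp
    simpa using h
  have hterm : ∀ (n : ℤ) (γ : ℝ),
      ‖c n * (Complex.exp (Complex.I * n * γ) * (Complex.I * n))‖ ≤ (n : ℝ) ^ 2 * ‖c n‖ := by
    intro n γ
    rw [norm_mul, norm_mul, norm_exp_I_int_mul, norm_mul, Complex.norm_I, one_mul, one_mul,
      Complex.norm_intCast, mul_comm]
    exact mul_le_mul_of_nonneg_right (hn1 n) (norm_nonneg _)
  have hgs : ∀ γ : ℝ, Summable fun n : ℤ =>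
      c n * (Complex.exp (Complex.I * n * γ) * (Complex.I * n)) := fun γ =>
    Summable.of_norm_bounded hs fun n => hterm n γ
  refine ⟨g, fun γ => ?_, fun γ => ?_, fun γ => ?_, fun γ δ => ?_⟩
  · rw [hfe]
    exact hasDerivAt_tsum hs (fun n y => (hexp n y).const_mul (c n)) hterm (hrep 0).summable γ
  · rw [← (hrep γ).tsum_eq]
    refine (tsum_of_norm_bounded hs'.hasSum fun n => ?_).trans ?_
    · rw [norm_mul, norm_exp_I_int_mul, mul_one]; exact hle n
    · rw [hs.tsum_add (hasSum_ite_eq 0 ‖c 0‖).summable, tsum_ite_eq]; linarith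
  · exact (tsum_of_norm_bounded hs.hasSum fun n => hterm n γ).trans hB
  · have hlip : ∀ n : ℤ, ‖Complex.exp (Complex.I * n * γ) - Complex.exp (Complex.I * n * δ)‖
        ≤ |(n : ℝ)| * |γ - δ| := by
      intro n
      have := Convex.norm_image_sub_le_of_norm_hasDerivWithin_le (s := univ) (C := |(n : ℝ)|)
        (x := δ) (y := γ) (fun x _ => (hexp n x).hasDerivWithinAt) (fun x _ => by
          rw [norm_mul, norm_exp_I_int_mul, norm_mul, Complex.norm_I, one_mul, one_mul,
            Complex.norm_intCast]) convex_univ (mem_univ _) (mem_univ _)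
      simpa [Real.norm_eq_abs] using this
    simp only [g]
    rw [← (hgs γ).tsum_sub (hgs δ)]
    have hb := (hs.mul_right |γ - δ|).hasSum
    refine (tsum_of_norm_bounded hb fun n => ?_).trans ?_
    · rw [← mul_sub, ← sub_mul, norm_mul, norm_mul, norm_mul, Complex.norm_I, one_mul,
        Complex.norm_intCast]
      calc ‖c n‖ * (‖Complex.exp (Complex.I * n * γ) - Complex.exp (Complex.I * n * δ)‖ * |(n : ℝ)|)
          ≤ ‖c n‖ * ((|(n : ℝ)| * |γ - δ|) * |(n : ℝ)|) := by gcongr; exact hlip n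
        _ = (n : ℝ) ^ 2 * ‖c n‖ * |γ - δ| := by rw [← sq_abs (n : ℝ)]; ring
    · rw [tsum_mul_right]; gcongr

/-! ### Curves with `C^{1,1}` bounds -/

/-- `X` is `2π`-periodic and `C^{1,1}`, with all bounds at most `M`. -/
structure BddC11 (M : ℝ) (X : ℝ → Plane) : Prop where
  periodic : Function.Periodic X (2 * π)
  differentiable : Differentiable ℝ X
  norm_le : ∀ γ, ‖X γ‖ ≤ M
  norm_deriv_le : ∀ γ, ‖deriv X γ‖ ≤ M
  norm_deriv_sub_le : ∀ γ δ, ‖deriv X γ - deriv X δ‖ ≤ M * |γ - δ|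

theorem norm_le_add_abs (v : Plane) : ‖v‖ ≤ |v 0| + |v 1| := by
  rw [EuclideanSpace.norm_eq, Real.sqrt_le_left (by positivity)]
  simp only [Fin.sum_univ_two, Real.norm_eq_abs]
  nlinarith [abs_nonneg (v 0), abs_nonneg (v 1)]

/-- Parseval with all other modes dropped; the normalising factor `1 / (2π)` is at most `1`. -/
theorem norm_coeff_zero_le {X : ℝ → Plane} (hX : Continuous X) {r : ℝ} (hr : 0 ≤ r)
    (h : ∫⁻ γ in Ioc (-π) π, ‖X γ‖ₑ ^ 2 ≤ ENNReal.ofReal (r ^ 2)) (i : Fin 2) :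
    ‖coeff X i 0‖ ≤ r := by
  have hf : Continuous fun γ : ℝ => ((X γ i : ℝ) : ℂ) := by fun_prop
  have hpi := Real.pi_pos
  have hint : IntegrableOn (fun γ => ‖((X γ i : ℝ) : ℂ)‖ ^ 2) (Ioc (-π) π) :=
    ((hf.norm.pow 2).continuousOn.integrableOn_Icc).mono_set Ioc_subset_Icc_self
  have hmem : MemLp (fun γ : ℝ => ((X γ i : ℝ) : ℂ)) 2 (volume.restrict (Ioc (-π) π)) := by
    rw [memLp_two_iff_integrable_sq_norm hf.aestronglyMeasurable]
    exact hint
  have hsum := hasSum_sq_fourierCoeffOn (neg_lt_self hpi) hmem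
  have h1 : ‖coeff X i 0‖ ^ 2 ≤ (π - -π)⁻¹ • ∫ x in (-π)..π, ‖((X x i : ℝ) : ℂ)‖ ^ 2 :=
    le_hasSum hsum 0 fun n _ => sq_nonneg _
  have h2 : ∫ x in (-π)..π, ‖((X x i : ℝ) : ℂ)‖ ^ 2 ≤ r ^ 2 := by
    rw [intervalIntegral.integral_of_le (by linarith),
      integral_eq_lintegral_of_nonneg_ae (ae_of_all _ fun x => sq_nonneg _)
        (hf.norm.pow 2).aestronglyMeasurable]
    refine ENNReal.toReal_le_of_le_ofReal (sq_nonneg r) (le_trans (lintegral_mono fun γ => ?_) h)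
    rw [ENNReal.ofReal_pow (norm_nonneg _), ← ofReal_norm]
    gcongr
    rw [Complex.norm_real]
    exact PiLp.norm_apply_le _ _
  have h3 : (π - -π)⁻¹ ≤ 1 := inv_le_one_of_one_le₀ (by linarith [Real.pi_gt_three])
  have h4 : 0 ≤ ∫ x in (-π)..π, ‖((X x i : ℝ) : ℂ)‖ ^ 2 :=
    intervalIntegral.integral_nonneg (by linarith) fun x _ => sq_nonneg _
  rw [smul_eq_mul] at h1
  have : ‖coeff X i 0‖ ^ 2 ≤ r ^ 2 := by nlinarith
  exact (sq_le_sq₀ (norm_nonneg _) hr).1 this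

theorem exists_deriv_coord {X : ℝ → Plane} (hX : Continuous X)
    (hper : Function.Periodic X (2 * π)) {r : ℝ} (hr : 0 ≤ r)
    (h : hLogNormSq 3 X ≤ ENNReal.ofReal (r ^ 2)) (i : Fin 2) :
    ∃ g : ℝ → ℝ, (∀ γ, HasDerivAt (fun γ => X γ i) (g γ) γ) ∧
      (∀ γ, |X γ i| ≤ 2 * (embeddingConst * r)) ∧ (∀ γ, |g γ| ≤ embeddingConst * r) ∧
      ∀ γ δ, |g γ - g δ| ≤ embeddingConst * r * |γ - δ| := by
  have hf : Continuous fun γ : ℝ => ((X γ i : ℝ) : ℂ) := by fun_prop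
  have hp : Function.Periodic (fun γ : ℝ => ((X γ i : ℝ) : ℂ)) (2 * π) := fun γ => by
    simp only [hper γ]
  have hL2 : ∫⁻ γ in Ioc (-π) π, ‖X γ‖ₑ ^ 2 ≤ ENNReal.ofReal (r ^ 2) := le_self_add.trans h
  have hS : hLogSeminormSq 3 X ≤ ENNReal.ofReal (r ^ 2) := le_add_self.trans h
  have hSi := (Finset.single_le_sum (f := fun i : Fin 2 => ∑' n : ℤ,
    ENNReal.ofReal (|(n : ℝ)| ^ (2 * 3) / Real.log (|(n : ℝ)| + Real.exp 1) ^ 2)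
      * ‖coeff X i n‖ₑ ^ 2) (fun _ _ => zero_le) (Finset.mem_univ i)).trans hS
  obtain ⟨hs, hB⟩ := summable_sq_mul_norm hr hSi
  have h0 : ‖coeff X i 0‖ ≤ embeddingConst * r :=
    (norm_coeff_zero_le hX hr hL2 i).trans (le_mul_of_one_le_left hr one_le_embeddingConst)
  obtain ⟨g, hg, hb0, hb1, hb2⟩ := exists_deriv_of_fourier_summable hf hp hs hB h0
  refine ⟨fun γ => (g γ).re, fun γ => ?_, fun γ => ?_, fun γ => ?_, fun γ δ => ?_⟩
  · have := Complex.reCLM.hasFDerivAt.comp_hasDerivAt γ (hg γ)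
    simpa [Function.comp_def] using this
  · simpa using hb0 γ
  · exact (Complex.abs_re_le_norm _).trans (hb1 γ)
  · rw [← Complex.sub_re]
    exact (Complex.abs_re_le_norm _).trans (hb2 γ δ)

theorem bddC11_of_hLogNormSq_le {X : ℝ → Plane} (hX : Continuous X)
    (hper : Function.Periodic X (2 * π)) {r : ℝ} (hr : 0 ≤ r)
    (h : hLogNormSq 3 X ≤ ENNReal.ofReal (r ^ 2)) :
    BddC11 (4 * embeddingConst * r) X := by
  choose g hg hb0 hb1 hb2 using exists_deriv_coord hX hper hr h
  have hd : Differentiable ℝ X :=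
    differentiable_euclidean.2 fun i γ => (hg i γ).differentiableAt
  have hdi : ∀ γ i, deriv X γ i = g i γ := fun γ i =>
    ((EuclideanSpace.proj (𝕜 := ℝ) i).hasFDerivAt.comp_hasDerivAt γ (hd γ).hasDerivAt).unique
      (hg i γ)
  have hK : 0 ≤ embeddingConst * r := mul_nonneg (by linarith [one_le_embeddingConst]) hr
  refine ⟨hper, hd, fun γ => ?_, fun γ => ?_, fun γ δ => ?_⟩
  · refine (norm_le_add_abs _).trans ?_
    linarith [hb0 0 γ, hb0 1 γ]
  · refine (norm_le_add_abs _).trans ?_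
    rw [hdi, hdi]
    linarith [hb1 0 γ, hb1 1 γ]
  · refine (norm_le_add_abs _).trans ?_
    rw [PiLp.sub_apply, PiLp.sub_apply, hdi, hdi, hdi, hdi]
    nlinarith [hb2 0 γ δ, hb2 1 γ δ, mul_nonneg hK (abs_nonneg (γ - δ))]

theorem BddC11.mono {M N : ℝ} {X : ℝ → Plane} (h : BddC11 M X) (hMN : M ≤ N) : BddC11 N X :=
  ⟨h.periodic, h.differentiable, fun γ => (h.norm_le γ).trans hMN,
    fun γ => (h.norm_deriv_le γ).trans hMN, fun γ δ => (h.norm_deriv_sub_le γ δ).trans (by gcongr)⟩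

theorem BddC11.add {M N : ℝ} {X Y : ℝ → Plane} (hX : BddC11 M X) (hY : BddC11 N Y) :
    BddC11 (M + N) (X + Y) := by
  have hd : deriv (X + Y) = deriv X + deriv Y := funext fun γ =>
    deriv_add (hX.differentiable γ) (hY.differentiable γ)
  refine ⟨hX.periodic.add hY.periodic, hX.differentiable.add hY.differentiable, fun γ => ?_,
    fun γ => ?_, fun γ δ => ?_⟩
  · exact (norm_add_le _ _).trans (add_le_add (hX.norm_le γ) (hY.norm_le γ))
  · rw [hd]
    exact (norm_add_le _ _).trans (add_le_add (hX.norm_deriv_le γ) (hY.norm_deriv_le γ))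
  · rw [hd, Pi.add_apply, Pi.add_apply, add_sub_add_comm, add_mul]
    exact (norm_add_le _ _).trans
      (add_le_add (hX.norm_deriv_sub_le γ δ) (hY.norm_deriv_sub_le γ δ))

theorem BddC11.nonneg {M : ℝ} {X : ℝ → Plane} (h : BddC11 M X) : 0 ≤ M :=
  (norm_nonneg _).trans (h.norm_le 0)

theorem BddC11.norm_sub_le {M : ℝ} {X : ℝ → Plane} (h : BddC11 M X) (γ δ : ℝ) :
    ‖X γ - X δ‖ ≤ M * |γ - δ| := by
  have := Convex.norm_image_sub_le_of_norm_deriv_le (s := univ) (x := δ) (y := γ)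
    (fun x _ => h.differentiable x) (fun x _ => h.norm_deriv_le x) convex_univ (mem_univ _)
    (mem_univ _)
  simpa [Real.norm_eq_abs] using this

theorem BddC11.continuous_deriv {M : ℝ} {X : ℝ → Plane} (h : BddC11 M X) :
    Continuous (deriv X) := by
  refine (LipschitzWith.of_dist_le_mul (K := ⟨M, h.nonneg⟩) fun γ δ => ?_).continuous
  rw [dist_eq_norm, Real.dist_eq]
  exact h.norm_deriv_sub_le γ δ

theorem BddC11.periodic_deriv {M : ℝ} {X : ℝ → Plane} (h : BddC11 M X) :
    Function.Periodic (deriv X) (2 * π) := fun γ => by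
  rw [← deriv_comp_add_const]
  exact congrArg (fun f => deriv f γ) (funext h.periodic)

/-! ### Arc-chord bounds, uniform in time -/

/-- With the denominator cleared, the bound is a closed condition on `(γ, η)`. It can fail in the
open square only on an open null set, which is empty; closure and periodicity in `γ` do the rest. -/
theorem ArcChordCondition.exists_le {X : ℝ → Plane} (hX : Continuous X)
    (hper : Function.Periodic X (2 * π)) (h : ArcChordCondition X) :
    ∃ c : ℝ, 0 ≤ c ∧ ∀ γ η, |η| ≤ π → |η| ≤ c * ‖X γ - X (γ - η)‖ := by
  set S := essSup (fun p : ℝ × ℝ => arcChord X p.1 p.2)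
    (volume.restrict (Icc (-π) π ×ˢ Icc (-π) π))
  have hpi := Real.pi_pos
  have hae : ∀ᵐ p : ℝ × ℝ ∂(volume.restrict (Icc (-π) π ×ˢ Icc (-π) π)),
      |p.2| ≤ S.toReal * ‖X p.1 - X (p.1 - p.2)‖ := by
    filter_upwards [ENNReal.ae_le_essSup (μ := volume.restrict (Icc (-π) π ×ˢ Icc (-π) π))
      (fun p : ℝ × ℝ => arcChord X p.1 p.2)] with p hp
    by_cases h0 : p.2 = 0
    · rw [h0, abs_zero]; positivity
    simp only [arcChord, if_neg h0] at hp
    have hne : ‖X p.1 - X (p.1 - p.2)‖ₑ ≠ 0 := by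
      intro hz
      rw [hz, ENNReal.div_zero (by simpa using h0)] at hp
      exact absurd h (not_lt.2 hp)
    have h1 := (ENNReal.div_le_iff hne enorm_ne_top).1 hp
    have h2 := ENNReal.toReal_mono (ENNReal.mul_ne_top h.ne enorm_ne_top) h1
    rwa [ENNReal.toReal_mul, toReal_enorm, toReal_enorm, Real.norm_eq_abs] at h2
  have hcl : IsClosed {p : ℝ × ℝ | |p.2| ≤ S.toReal * ‖X p.1 - X (p.1 - p.2)‖} :=
    isClosed_le (by fun_prop) (by fun_prop)
  have hsub : Ioo (-π) π ×ˢ Ioo (-π) π ⊆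
      {p : ℝ × ℝ | |p.2| ≤ S.toReal * ‖X p.1 - X (p.1 - p.2)‖} := by
    have ho : IsOpen ({p : ℝ × ℝ | |p.2| ≤ S.toReal * ‖X p.1 - X (p.1 - p.2)‖}ᶜ ∩
        (Ioo (-π) π ×ˢ Ioo (-π) π)) := hcl.isOpen_compl.inter (isOpen_Ioo.prod isOpen_Ioo)
    have hm : (volume : Measure (ℝ × ℝ))
        ({p : ℝ × ℝ | |p.2| ≤ S.toReal * ‖X p.1 - X (p.1 - p.2)‖}ᶜ ∩
        (Ioo (-π) π ×ˢ Ioo (-π) π)) = 0 := by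
      have := mem_ae_iff.1 hae
      rw [Measure.restrict_apply hcl.isOpen_compl.measurableSet] at this
      exact measure_mono_null (inter_subset_inter_right _
        (prod_mono Ioo_subset_Icc_self Ioo_subset_Icc_self)) this
    have he := ho.eq_empty_of_measure_zero hm
    intro p hp
    by_contra hn
    exact notMem_empty p (he ▸ mem_inter (mem_compl hn) hp)
  have hsub' : Icc (-π) π ×ˢ Icc (-π) π ⊆
      {p : ℝ × ℝ | |p.2| ≤ S.toReal * ‖X p.1 - X (p.1 - p.2)‖} := by
    have hne : -π ≠ π := by linarith
    rw [← closure_Ioo hne, ← closure_prod_eq]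
    exact hcl.closure_subset_iff.2 hsub
  refine ⟨S.toReal, ENNReal.toReal_nonneg, fun γ η hη => ?_⟩
  have hp : Function.Periodic (fun γ => ‖X γ - X (γ - η)‖) (2 * π) := fun γ => by
    simp only [hper γ, add_sub_right_comm, hper (γ - η)]
  obtain ⟨γ', hγ', he⟩ := hp.exists_mem_Ico (by linarith) γ (-π)
  rw [he]
  exact hsub' (show (γ', η) ∈ _ from
    ⟨⟨hγ'.1, by linarith [hγ'.2]⟩, abs_le.1 hη⟩)

/-- A `C^{1,1}` curve with a quantitative arc-chord bound. -/
structure Admissible (M : ℝ) (X : ℝ → Plane) : Prop extends BddC11 M X where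
  chord : ∀ γ η, |η| ≤ π → |η| ≤ M * ‖X γ - X (γ - η)‖

theorem Admissible.mono {M N : ℝ} {X : ℝ → Plane} (h : Admissible M X) (hMN : M ≤ N) :
    Admissible N X :=
  ⟨h.toBddC11.mono hMN, fun γ η hη => (h.chord γ η hη).trans (by gcongr)⟩

theorem MemHLog.hLogNormSq_lt_top {k : ℕ} {X : ℝ → Plane} (h : MemHLog k X) :
    hLogNormSq k X < ∞ := by
  refine ENNReal.add_lt_top.2 ⟨?_, h.2.2⟩
  have := (h.2.1.integrable_norm_pow two_ne_zero).hasFiniteIntegral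
  simpa [HasFiniteIntegral, enorm_pow] using this

section
variable {T : ℝ} {x : ℝ → ℝ → Plane}

theorem IsSolution.exists_bddC11 (hx : IsSolution T x) {t : ℝ} (ht : t ∈ Icc 0 T) :
    ∃ M, BddC11 M (x t) := by
  have hm := hx.continuousInHLog.1 t ht
  refine ⟨_, bddC11_of_hLogNormSq_le (hx.continuous_curve t ht) hm.1
    (Real.sqrt_nonneg (hLogNormSq 3 (x t)).toReal) ?_⟩
  rw [Real.sq_sqrt ENNReal.toReal_nonneg, ENNReal.ofReal_toReal hm.hLogNormSq_lt_top.ne]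

theorem IsSolution.eventually_bddC11_sub (hx : IsSolution T x) {t₀ : ℝ} (ht₀ : t₀ ∈ Icc 0 T)
    {ε : ℝ} (hε : 0 < ε) : ∀ᶠ t in 𝓝[Icc 0 T] t₀, BddC11 ε (x t - x t₀) := by
  have hK : 0 < embeddingConst := by linarith [one_le_embeddingConst]
  set r := ε / (4 * embeddingConst) with hr
  have hr0 : 0 < r := by positivity
  have h := (hx.continuousInHLog.2 t₀ ht₀).eventually
    (gt_mem_nhds (show (0 : ℝ≥0∞) < ENNReal.ofReal (r ^ 2) by positivity))
  filter_upwards [h, self_mem_nhdsWithin] with t ht htm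
  have hb := bddC11_of_hLogNormSq_le
    ((hx.continuous_curve t htm).sub (hx.continuous_curve t₀ ht₀))
    ((hx.continuousInHLog.1 t htm).1.sub (hx.continuousInHLog.1 t₀ ht₀).1) hr0.le ht.le
  exact hb.mono (by rw [hr]; field_simp; exact le_rfl)

/-- The chord bound is stable under small Lipschitz perturbations: a Lipschitz constant `1 / (2 (c +
1))` costs at most `|η| / 2`, so `c` becomes at most `2 * c`. -/
theorem IsSolution.eventually_admissible (hx : IsSolution T x) {t₀ : ℝ} (ht₀ : t₀ ∈ Icc 0 T) :
    ∃ M, ∀ᶠ t in 𝓝[Icc 0 T] t₀, Admissible M (x t) := by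
  obtain ⟨M, hM⟩ := hx.exists_bddC11 ht₀
  obtain ⟨c, hc, hchord⟩ := (hx.arcChord t₀ ht₀).exists_le (hx.continuous_curve t₀ ht₀) hM.periodic
  have hε : 0 < 1 / (2 * (c + 1)) := by positivity
  refine ⟨M + 1 + 2 * c, ?_⟩
  filter_upwards [hx.eventually_bddC11_sub ht₀ hε] with t ht
  have hε1 : 1 / (2 * (c + 1)) ≤ 1 := by rw [div_le_one (by positivity)]; linarith
  refine ⟨?_, fun γ η hη => ?_⟩
  · have := hM.add ht
    rw [add_sub_cancel] at this
    exact this.mono (by linarith)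
  · have h1 := hchord γ η hη
    have h2 := ht.norm_sub_le γ (γ - η)
    rw [sub_sub_cancel, Pi.sub_apply, Pi.sub_apply] at h2
    have h3 : ‖x t₀ γ - x t₀ (γ - η)‖ ≤ ‖x t γ - x t (γ - η)‖ + 1 / (2 * (c + 1)) * |η| := by
      have := norm_sub_le (x t γ - x t (γ - η)) (x t γ - x t₀ γ - (x t (γ - η) - x t₀ (γ - η)))
      rw [show x t γ - x t (γ - η) - (x t γ - x t₀ γ - (x t (γ - η) - x t₀ (γ - η)))
        = x t₀ γ - x t₀ (γ - η) by abel] at this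
      linarith
    have h4 : c * (1 / (2 * (c + 1))) ≤ 1 / 2 := by
      rw [mul_one_div, div_le_div_iff₀ (by positivity) (by norm_num)]; linarith
    have h5 : |η| ≤ 2 * c * ‖x t γ - x t (γ - η)‖ := by
      have := mul_le_mul_of_nonneg_left h3 hc
      nlinarith [abs_nonneg η]
    have := hM.nonneg
    nlinarith [norm_nonneg (x t γ - x t (γ - η))]

theorem IsSolution.exists_admissible (hx : IsSolution T x) :
    ∃ M, ∀ t ∈ Icc 0 T, Admissible M (x t) := by
  refine isCompact_Icc.induction_on (p := fun s => ∃ M, ∀ t ∈ s, Admissible M (x t))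
    ⟨0, fun t ht => ht.elim⟩ (fun s u hsu ⟨M, hM⟩ => ⟨M, fun t ht => hM t (hsu ht)⟩)
    (fun s u ⟨M, hM⟩ ⟨N, hN⟩ => ⟨max M N, fun t ht => ?_⟩) fun t ht => ?_
  · rcases ht with ht | ht
    · exact (hM t ht).mono (le_max_left _ _)
    · exact (hN t ht).mono (le_max_right _ _)
  · obtain ⟨M, hM⟩ := hx.eventually_admissible ht
    exact ⟨_, hM, M, fun t ht => ht⟩

theorem IsSolution.continuousOn (hx : IsSolution T x) (γ : ℝ) :
    ContinuousOn (fun t => x t γ) (Icc 0 T) := by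
  intro t₀ ht₀
  refine Metric.tendsto_nhds.2 fun ε hε => ?_
  filter_upwards [hx.eventually_bddC11_sub ht₀ (half_pos hε)] with t ht
  rw [dist_eq_norm]
  exact (ht.norm_le γ).trans_lt (half_lt_self hε)

end

/-! ### Symmetrization of the energy derivative -/

/-- The integrand of the velocity. -/
noncomputable def velocityKernel (X : ℝ → Plane) (γ η : ℝ) : Plane :=
  ‖X γ - X (γ - η)‖⁻¹ • (deriv X γ - deriv X (γ - η))

theorem velocityKernel_sub_neg (X : ℝ → Plane) (γ η : ℝ) :
    velocityKernel X (γ - η) (-η) = -velocityKernel X γ η := by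
  rw [velocityKernel, velocityKernel, sub_neg_eq_add, sub_add_cancel, norm_sub_rev, ← smul_neg,
    neg_sub]

section
variable {M : ℝ} {X Y : ℝ → Plane}

theorem Admissible.inv_norm_mul_le (h : Admissible M X) (γ : ℝ) {η : ℝ} (hη : |η| ≤ π) :
    ‖X γ - X (γ - η)‖⁻¹ * |η| ≤ M := by
  -- A vanishing chord, as at `η = 0`, has inverse `0` by convention.
  rcases eq_or_ne (‖X γ - X (γ - η)‖) 0 with h0 | h0
  · rw [h0, inv_zero, zero_mul]; exact h.toBddC11.nonneg
  · rw [inv_mul_le_iff₀ (lt_of_le_of_ne (norm_nonneg _) h0.symm), mul_comm]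
    exact h.chord γ η hη

/-- The Lipschitz bound on the tangent cancels the singularity `1/|η|`. Boundedness of the kernel
later justifies Fubini and differentiation under the integral. -/
theorem Admissible.norm_velocityKernel_le (h : Admissible M X) (γ : ℝ) {η : ℝ} (hη : |η| ≤ π) :
    ‖velocityKernel X γ η‖ ≤ M ^ 2 := by
  have h1 := h.norm_deriv_sub_le γ (γ - η)
  rw [sub_sub_cancel] at h1
  rw [velocityKernel, norm_smul, norm_inv, norm_norm]
  calc ‖X γ - X (γ - η)‖⁻¹ * ‖deriv X γ - deriv X (γ - η)‖
      ≤ ‖X γ - X (γ - η)‖⁻¹ * (M * |η|) := by gcongr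
    _ = M * (‖X γ - X (γ - η)‖⁻¹ * |η|) := by ring
    _ ≤ M * M := by
        gcongr
        · exact h.toBddC11.nonneg
        · exact h.inv_norm_mul_le γ hη
    _ = M ^ 2 := by ring

theorem BddC11.measurable_velocityKernel (h : BddC11 M X) :
    Measurable fun p : ℝ × ℝ => velocityKernel X p.1 p.2 := by
  have h1 := h.differentiable.continuous
  have h2 := h.continuous_deriv
  have h3 : Measurable fun p : ℝ × ℝ => X p.1 - X (p.1 - p.2) :=
    (by fun_prop : Continuous fun p : ℝ × ℝ => X p.1 - X (p.1 - p.2)).measurable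
  have h4 : Measurable fun p : ℝ × ℝ => deriv X p.1 - deriv X (p.1 - p.2) :=
    (by fun_prop : Continuous fun p : ℝ × ℝ => deriv X p.1 - deriv X (p.1 - p.2)).measurable
  exact h3.norm.inv.smul h4

theorem BddC11.stronglyMeasurable_velocity (h : BddC11 M X) : StronglyMeasurable (velocity X) := by
  have : velocity X = fun γ => ∫ η in Ioc (-π) π, velocityKernel X γ η := funext fun γ =>
    intervalIntegral.integral_of_le (by linarith [Real.pi_pos])
  rw [this]
  exact h.measurable_velocityKernel.stronglyMeasurable.integral_prod_right

theorem Admissible.norm_velocity_le (h : Admissible M X) (γ : ℝ) :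
    ‖velocity X γ‖ ≤ M ^ 2 * (2 * π) := by
  have hpi := Real.pi_pos
  refine (intervalIntegral.norm_integral_le_of_norm_le_const (C := M ^ 2) fun η hη => ?_).trans ?_
  · rw [uIoc_of_le (by linarith)] at hη
    exact h.norm_velocityKernel_le γ (abs_le.2 ⟨hη.1.le, hη.2⟩)
  · rw [show π - -π = 2 * π by ring, abs_of_pos (by linarith)]

theorem intervalIntegral_comp_sub_of_periodic {f : ℝ → ℝ} (hf : Function.Periodic f (2 * π))
    (η : ℝ) : ∫ γ in (-π)..π, f (γ - η) = ∫ γ in (-π)..π, f γ := by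
  rw [intervalIntegral.integral_comp_sub_right]
  have := hf.intervalIntegral_add_eq (-π - η) (-π)
  rw [show -π - η + 2 * π = π - η by ring, show -π + 2 * π = π by ring] at this
  exact this

/-- The integrand of the time derivative of half the energy. -/
noncomputable def energyKernel (X Y : ℝ → Plane) (γ η : ℝ) : ℝ :=
  inner ℝ (X γ - Y γ) (velocityKernel X γ η - velocityKernel Y γ η)

theorem Admissible.abs_energyKernel_le (hX : Admissible M X) (hY : Admissible M Y) (γ : ℝ) {η : ℝ}
    (hη : |η| ≤ π) : |energyKernel X Y γ η| ≤ 2 * M * (2 * M ^ 2) := by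
  refine (abs_real_inner_le_norm _ _).trans ?_
  have h0 := hX.toBddC11.nonneg
  gcongr
  · refine (norm_sub_le _ _).trans ?_
    linarith [hX.norm_le γ, hY.norm_le γ]
  · refine (norm_sub_le _ _).trans ?_
    linarith [hX.norm_velocityKernel_le γ hη, hY.norm_velocityKernel_le γ hη]

theorem BddC11.measurable_energyKernel (hX : BddC11 M X) (hY : BddC11 M Y) :
    Measurable fun p : ℝ × ℝ => energyKernel X Y p.1 p.2 := by
  have h1 : Measurable fun p : ℝ × ℝ => X p.1 - Y p.1 :=
    (hX.differentiable.continuous.measurable.comp measurable_fst).sub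
      (hY.differentiable.continuous.measurable.comp measurable_fst)
  exact h1.inner (hX.measurable_velocityKernel.sub hY.measurable_velocityKernel)

theorem Admissible.integrable_energyKernel (hX : Admissible M X) (hY : Admissible M Y) :
    Integrable (fun p : ℝ × ℝ => energyKernel X Y p.1 p.2)
      ((volume.restrict (Ioc (-π) π)).prod (volume.restrict (Ioc (-π) π))) := by
  refine Integrable.of_bound (hX.toBddC11.measurable_energyKernel hY.toBddC11).aestronglyMeasurable
    (2 * M * (2 * M ^ 2)) ?_
  rw [Measure.prod_restrict]
  refine (ae_restrict_iff' (measurableSet_Ioc.prod measurableSet_Ioc)).2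
    (ae_of_all _ fun p hp => ?_)
  exact hX.abs_energyKernel_le hY p.1 (abs_le.2 ⟨hp.2.1.le, hp.2.2⟩)

/-- Fubini, then the half `η < 0` is folded onto `η > 0` so that opposite shifts can be paired. -/
theorem Admissible.integral_inner_velocity_sub (hX : Admissible M X) (hY : Admissible M Y) :
    IntervalIntegrable (fun η => (∫ γ in (-π)..π, energyKernel X Y γ η) +
        ∫ γ in (-π)..π, energyKernel X Y γ (-η)) volume 0 π ∧
    ∫ γ in (-π)..π, inner ℝ (X γ - Y γ) (velocity X γ - velocity Y γ) =
      ∫ η in (0)..π, ((∫ γ in (-π)..π, energyKernel X Y γ η) +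
        ∫ γ in (-π)..π, energyKernel X Y γ (-η)) := by
  have hpi := Real.pi_pos
  have hle : -π ≤ π := by linarith
  have hker : ∀ {Z : ℝ → Plane}, Admissible M Z → ∀ γ,
      IntegrableOn (fun η => velocityKernel Z γ η) (Ioc (-π) π) := by
    intro Z hZ γ
    refine Integrable.of_bound
      (hZ.toBddC11.measurable_velocityKernel.comp measurable_prodMk_left).aestronglyMeasurable
      (M ^ 2) ?_
    exact (ae_restrict_iff' measurableSet_Ioc).2 (ae_of_all _ fun η hη =>
      hZ.norm_velocityKernel_le γ (abs_le.2 ⟨hη.1.le, hη.2⟩))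
  have h1 : ∀ γ, inner ℝ (X γ - Y γ) (velocity X γ - velocity Y γ) =
      ∫ η in Ioc (-π) π, energyKernel X Y γ η := by
    intro γ
    have e : ∀ Z : ℝ → Plane, velocity Z γ = ∫ η in Ioc (-π) π, velocityKernel Z γ η := fun Z =>
      intervalIntegral.integral_of_le hle
    rw [e X, e Y, ← integral_sub (hker hX γ) (hker hY γ)]
    exact (integral_inner ((hker hX γ).sub (hker hY γ)) _).symm
  have hint := hX.integrable_energyKernel hY
  have hR : IntervalIntegrable (fun η => ∫ γ in (-π)..π, energyKernel X Y γ η) volume (-π) π := by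
    simp_rw [intervalIntegral.integral_of_le hle]
    exact (intervalIntegrable_iff_integrableOn_Ioc_of_le hle).2 hint.integral_prod_right
  have hR1 : IntervalIntegrable (fun η => ∫ γ in (-π)..π, energyKernel X Y γ η) volume 0 π :=
    hR.mono_set (uIcc_subset_uIcc
      (by rw [uIcc_of_le hle]; exact ⟨by linarith, hpi.le⟩) right_mem_uIcc)
  have hR2 : IntervalIntegrable (fun η => ∫ γ in (-π)..π, energyKernel X Y γ η) volume (-π) 0 :=
    hR.mono_set (uIcc_subset_uIcc left_mem_uIcc
      (by rw [uIcc_of_le hle]; exact ⟨by linarith, hpi.le⟩))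
  have hR3 : IntervalIntegrable (fun η => ∫ γ in (-π)..π, energyKernel X Y γ (-η)) volume 0 π := by
    simpa using ((IntervalIntegrable.iff_comp_neg).1 hR2).symm
  refine ⟨hR1.add hR3, ?_⟩
  calc ∫ γ in (-π)..π, inner ℝ (X γ - Y γ) (velocity X γ - velocity Y γ)
      = ∫ γ in Ioc (-π) π, ∫ η in Ioc (-π) π, energyKernel X Y γ η := by
        rw [intervalIntegral.integral_of_le hle]; simp_rw [h1]
    _ = ∫ η in Ioc (-π) π, ∫ γ in Ioc (-π) π, energyKernel X Y γ η :=
        integral_integral_swap hint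
    _ = ∫ η in (-π)..π, ∫ γ in (-π)..π, energyKernel X Y γ η := by
        simp_rw [intervalIntegral.integral_of_le hle]
    _ = _ := by
        rw [← intervalIntegral.integral_add_adjacent_intervals hR2 hR1,
          intervalIntegral.integral_add hR1 hR3, add_comm]
        congr 1
        rw [intervalIntegral.integral_comp_neg
          (fun η => ∫ γ in (-π)..π, energyKernel X Y γ η), neg_zero]

theorem periodic_energyKernel (hX : BddC11 M X) (hY : BddC11 M Y) (η : ℝ) :
    Function.Periodic (fun γ => energyKernel X Y γ η) (2 * π) := fun γ => by
  simp only [energyKernel, velocityKernel, add_sub_right_comm _ (2 * π) η, hX.periodic γ,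
    hY.periodic γ, hX.periodic (γ - η), hY.periodic (γ - η), hX.periodic_deriv γ,
    hY.periodic_deriv γ, hX.periodic_deriv (γ - η), hY.periodic_deriv (γ - η)]

theorem BddC11.continuous_energyKernel (hX : BddC11 M X) (hY : BddC11 M Y) {η : ℝ}
    (hXη : ∀ γ, X γ - X (γ - η) ≠ 0) (hYη : ∀ γ, Y γ - Y (γ - η) ≠ 0) :
    Continuous fun γ => energyKernel X Y γ η := by
  have h1 := hX.differentiable.continuous
  have h2 := hX.continuous_deriv
  have h3 := hY.differentiable.continuous
  have h4 := hY.continuous_deriv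
  have hk1 : Continuous fun γ => ‖X γ - X (γ - η)‖⁻¹ :=
    Continuous.inv₀ (by fun_prop) fun γ => norm_ne_zero_iff.2 (hXη γ)
  have hk2 : Continuous fun γ => ‖Y γ - Y (γ - η)‖⁻¹ :=
    Continuous.inv₀ (by fun_prop) fun γ => norm_ne_zero_iff.2 (hYη γ)
  unfold energyKernel velocityKernel
  fun_prop

/-- Translating the second integral by `η` turns its kernel into minus that of the first, so the
test function `X - Y` is replaced by its difference over the step `η`. -/
theorem BddC11.integral_energyKernel_add_neg (hX : BddC11 M X) (hY : BddC11 M Y) {η : ℝ}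
    (hXη : ∀ γ, X γ - X (γ - η) ≠ 0) (hYη : ∀ γ, Y γ - Y (γ - η) ≠ 0) :
    (∫ γ in (-π)..π, energyKernel X Y γ η) + ∫ γ in (-π)..π, energyKernel X Y γ (-η) =
      ∫ γ in (-π)..π, inner ℝ (X γ - X (γ - η) - (Y γ - Y (γ - η)))
        (velocityKernel X γ η - velocityKernel Y γ η) := by
  have hc := hX.continuous_energyKernel hY hXη hYη
  have hXn : ∀ γ, X γ - X (γ - -η) ≠ 0 := fun γ h => hXη (γ + η) (by
    rw [add_sub_cancel_right, ← neg_sub, neg_eq_zero, ← h, sub_neg_eq_add])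
  have hYn : ∀ γ, Y γ - Y (γ - -η) ≠ 0 := fun γ h => hYη (γ + η) (by
    rw [add_sub_cancel_right, ← neg_sub, neg_eq_zero, ← h, sub_neg_eq_add])
  have hcn : Continuous fun γ => energyKernel X Y (γ - η) (-η) :=
    (hX.continuous_energyKernel hY hXn hYn).comp (continuous_id.sub continuous_const)
  rw [← intervalIntegral_comp_sub_of_periodic (periodic_energyKernel hX hY (-η)) η,
    ← intervalIntegral.integral_add (hc.intervalIntegrable _ _)
      (hcn.intervalIntegrable _ _)]
  congr 1
  ext γ
  simp only [energyKernel, velocityKernel_sub_neg]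
  rw [neg_sub_neg, ← neg_sub (velocityKernel X γ η), inner_neg_right, ← sub_eq_add_neg,
    ← inner_sub_left]
  congr 1
  abel

end

/-! ### The energy inequality with logarithmic loss -/

theorem abs_inv_norm_sub_inv_norm_le {a b : Plane} (ha : a ≠ 0) (hb : b ≠ 0) :
    |‖a‖⁻¹ - ‖b‖⁻¹| ≤ ‖a - b‖ * (‖a‖⁻¹ * ‖b‖⁻¹) := by
  have ha' := norm_pos_iff.2 ha
  have hb' := norm_pos_iff.2 hb
  rw [show ‖a‖⁻¹ - ‖b‖⁻¹ = (‖b‖ - ‖a‖) * (‖a‖⁻¹ * ‖b‖⁻¹) by field_simp, abs_mul,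
    abs_of_nonneg (show 0 ≤ ‖a‖⁻¹ * ‖b‖⁻¹ by positivity)]
  gcongr
  rw [norm_sub_rev]
  exact abs_norm_sub_norm_le b a

/-- `inner (a - b) (‖a‖⁻¹ • a' - ‖b‖⁻¹ • b')` is half the derivative of `‖a - b‖² / ‖a‖`, up to an
error controlled by `‖a - b‖²`. -/
theorem inner_sub_kernel_le {M η : ℝ} (hη : 0 < η) {a b a' b' : Plane}
    (ha : η ≤ M * ‖a‖) (hb : η ≤ M * ‖b‖) (ha' : ‖a'‖ ≤ M * η) (hb' : ‖b'‖ ≤ M * η) :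
    inner ℝ (a - b) (‖a‖⁻¹ • a' - ‖b‖⁻¹ • b') ≤
      1 / 2 * ((2 * inner ℝ (a - b) (a' - b') * ‖a‖ - ‖a - b‖ ^ 2 * (inner ℝ a a' / ‖a‖)) / ‖a‖ ^ 2)
        + 3 / 2 * M ^ 3 * (‖a - b‖ ^ 2 / η) := by
  have hM : 0 ≤ M := nonneg_of_mul_nonneg_left ((norm_nonneg _).trans ha') hη
  have ha0 : ‖a‖ ≠ 0 := fun h => by rw [h] at ha; linarith
  have hb0 : ‖b‖ ≠ 0 := fun h => by rw [h] at hb; linarith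
  have ha1 : 0 < ‖a‖ := lt_of_le_of_ne (norm_nonneg _) ha0.symm
  have hb1 : 0 < ‖b‖ := lt_of_le_of_ne (norm_nonneg _) hb0.symm
  have hai : ‖a‖⁻¹ ≤ M / η := by
    rw [inv_le_iff_one_le_mul₀ ha1, div_mul_eq_mul_div, one_le_div hη]; exact ha
  have hbi : ‖b‖⁻¹ ≤ M / η := by
    rw [inv_le_iff_one_le_mul₀ hb1, div_mul_eq_mul_div, one_le_div hη]; exact hb
  -- Total derivative, plus the term from differentiating `1/‖a‖` (bounded in `e1`, contributing
  -- `1/2`), plus the difference of the inverse lengths (`e2`, contributing `1`).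
  have hid : inner ℝ (a - b) (‖a‖⁻¹ • a' - ‖b‖⁻¹ • b') =
      1 / 2 * ((2 * inner ℝ (a - b) (a' - b') * ‖a‖ - ‖a - b‖ ^ 2 * (inner ℝ a a' / ‖a‖)) / ‖a‖ ^ 2)
        + 1 / 2 * (‖a - b‖ ^ 2 * (inner ℝ a a' * (‖a‖⁻¹ * ‖a‖⁻¹ * ‖a‖⁻¹)))
        + (‖a‖⁻¹ - ‖b‖⁻¹) * inner ℝ (a - b) b' := by
    rw [inner_sub_right, inner_sub_right, inner_smul_right, inner_smul_right]
    field_simp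
    ring
  have e1 : inner ℝ a a' * (‖a‖⁻¹ * ‖a‖⁻¹ * ‖a‖⁻¹) ≤ M ^ 3 / η := by
    calc inner ℝ a a' * (‖a‖⁻¹ * ‖a‖⁻¹ * ‖a‖⁻¹)
        ≤ (‖a‖ * ‖a'‖) * (‖a‖⁻¹ * ‖a‖⁻¹ * ‖a‖⁻¹) := by
          gcongr
          exact real_inner_le_norm _ _
      _ = ‖a'‖ * (‖a‖⁻¹ * ‖a‖⁻¹) := by field_simp
      _ ≤ (M * η) * (M / η * (M / η)) := by gcongr
      _ = M ^ 3 / η := by field_simp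
  have e2 : (‖a‖⁻¹ - ‖b‖⁻¹) * inner ℝ (a - b) b' ≤ M ^ 3 * (‖a - b‖ ^ 2 / η) := by
    calc (‖a‖⁻¹ - ‖b‖⁻¹) * inner ℝ (a - b) b'
        ≤ |‖a‖⁻¹ - ‖b‖⁻¹| * |inner ℝ (a - b) b'| := by rw [← abs_mul]; exact le_abs_self _
      _ ≤ (‖a - b‖ * (‖a‖⁻¹ * ‖b‖⁻¹)) * (‖a - b‖ * ‖b'‖) := by
          gcongr
          · exact abs_inv_norm_sub_inv_norm_le (norm_pos_iff.1 ha1) (norm_pos_iff.1 hb1)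
          · exact abs_real_inner_le_norm _ _
      _ ≤ (‖a - b‖ * (M / η * (M / η))) * (‖a - b‖ * (M * η)) := by gcongr
      _ = M ^ 3 * (‖a - b‖ ^ 2 / η) := by field_simp
  have e3 := mul_le_mul_of_nonneg_left e1 (sq_nonneg ‖a - b‖)
  rw [hid]
  have : ‖a - b‖ ^ 2 * (M ^ 3 / η) = M ^ 3 * (‖a - b‖ ^ 2 / η) := by ring
  linarith

/-- Regularizes `1/η` to the integrable `1/(η + ε)`. The extra term `ε w²` is absorbed by using the
Lipschitz bound on one factor `w`, then `2 ε w ≤ ε² + w²`. -/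
theorem sq_div_le_div_add {M η ε w : ℝ} (hη : 0 < η) (hε : 0 < ε) (hM : 0 ≤ M) (hw0 : 0 ≤ w)
    (hw : w ≤ 2 * M * η) : w ^ 2 / η ≤ (M + 1) * (w ^ 2 + ε ^ 2) / (η + ε) := by
  rw [div_le_div_iff₀ hη (by positivity)]
  have h1 : ε * w ^ 2 ≤ 2 * M * η * (ε * w) := by nlinarith [mul_nonneg hε.le hw0]
  have h2 : M * η * (2 * (ε * w)) ≤ M * η * (ε ^ 2 + w ^ 2) := by
    gcongr
    nlinarith [sq_nonneg (ε - w)]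
  nlinarith [mul_pos hη (pow_pos hε 2)]

section
variable {M : ℝ} {X Y : ℝ → Plane}

theorem BddC11.hasDerivAt_sub_comp (h : BddC11 M X) (γ η : ℝ) :
    HasDerivAt (fun γ => X γ - X (γ - η)) (deriv X γ - deriv X (γ - η)) γ :=
  (h.differentiable γ).hasDerivAt.sub ((h.differentiable (γ - η)).hasDerivAt.comp_sub_const γ η)

theorem Admissible.integral_inner_velocityKernel_sub_le (hX : Admissible M X)
    (hY : Admissible M Y) {η : ℝ} (hη : 0 < η) (hηπ : η ≤ π) :
    ∫ γ in (-π)..π, inner ℝ (X γ - X (γ - η) - (Y γ - Y (γ - η)))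
        (velocityKernel X γ η - velocityKernel Y γ η) ≤
      3 / 2 * M ^ 3 * ∫ γ in (-π)..π, ‖X γ - X (γ - η) - (Y γ - Y (γ - η))‖ ^ 2 / η := by
  have hpi := Real.pi_pos
  have habs : |η| ≤ π := by rwa [abs_of_pos hη]
  have hchX : ∀ γ, η ≤ M * ‖X γ - X (γ - η)‖ := fun γ => (le_abs_self η).trans (hX.chord γ η habs)
  have hchY : ∀ γ, η ≤ M * ‖Y γ - Y (γ - η)‖ := fun γ => (le_abs_self η).trans (hY.chord γ η habs)
  have hXη : ∀ γ, X γ - X (γ - η) ≠ 0 := fun γ h => by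
    have := hchX γ; rw [h, norm_zero] at this; linarith
  have hYη : ∀ γ, Y γ - Y (γ - η) ≠ 0 := fun γ h => by
    have := hchY γ; rw [h, norm_zero] at this; linarith
  have hdX : ∀ γ, ‖deriv X γ - deriv X (γ - η)‖ ≤ M * η := fun γ => by
    simpa [abs_of_pos hη] using hX.norm_deriv_sub_le γ (γ - η)
  have hdY : ∀ γ, ‖deriv Y γ - deriv Y (γ - η)‖ ≤ M * η := fun γ => by
    simpa [abs_of_pos hη] using hY.norm_deriv_sub_le γ (γ - η)
  have cX := hX.differentiable.continuous
  have cX' := hX.continuous_deriv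
  have cY := hY.differentiable.continuous
  have cY' := hY.continuous_deriv
  have hk : ∀ γ, ‖X γ - X (γ - η)‖ ≠ 0 := fun γ => norm_ne_zero_iff.2 (hXη γ)
  have hkY : ∀ γ, ‖Y γ - Y (γ - η)‖ ≠ 0 := fun γ => norm_ne_zero_iff.2 (hYη γ)
  set u : ℝ → ℝ := fun γ => ‖X γ - X (γ - η) - (Y γ - Y (γ - η))‖ ^ 2 / ‖X γ - X (γ - η)‖
  set u' : ℝ → ℝ := fun γ =>
    (2 * inner ℝ (X γ - X (γ - η) - (Y γ - Y (γ - η)))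
        (deriv X γ - deriv X (γ - η) - (deriv Y γ - deriv Y (γ - η))) * ‖X γ - X (γ - η)‖ -
      ‖X γ - X (γ - η) - (Y γ - Y (γ - η))‖ ^ 2 *
        (inner ℝ (X γ - X (γ - η)) (deriv X γ - deriv X (γ - η)) / ‖X γ - X (γ - η)‖)) /
      ‖X γ - X (γ - η)‖ ^ 2
  have hu : ∀ γ, HasDerivAt u (u' γ) γ := by
    intro γ
    have h1 := hX.toBddC11.hasDerivAt_sub_comp γ η
    have h2 := (h1.sub (hY.toBddC11.hasDerivAt_sub_comp γ η)).norm_sq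
    have h3 : HasDerivAt (fun γ => ‖X γ - X (γ - η)‖)
        (inner ℝ (X γ - X (γ - η)) (deriv X γ - deriv X (γ - η)) / ‖X γ - X (γ - η)‖) γ := by
      have h4 := h1.norm_sq.sqrt (pow_ne_zero 2 (hk γ))
      simp only [Real.sqrt_sq (norm_nonneg _)] at h4
      rwa [mul_div_mul_left _ _ (two_ne_zero)] at h4
    exact h2.div h3 (hk γ)
  have hu'c : Continuous u' := by
    refine Continuous.div ?_ (by fun_prop) fun γ => pow_ne_zero 2 (hk γ)
    refine Continuous.sub (by fun_prop) (Continuous.mul (by fun_prop) ?_)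
    exact Continuous.div (by fun_prop) (by fun_prop) hk
  -- The only term containing derivatives of `X - Y` is exact, and `u` is periodic.
  have hu0 : ∫ γ in (-π)..π, u' γ = 0 := by
    rw [intervalIntegral.integral_eq_sub_of_hasDerivAt (fun γ _ => hu γ)
      (hu'c.intervalIntegrable _ _), sub_eq_zero]
    have e : ∀ {Z : ℝ → Plane}, Function.Periodic Z (2 * π) → Z (-π) = Z π ∧
        Z (-π - η) = Z (π - η) := by
      intro Z hZ
      constructor
      · rw [← hZ (-π)]; congr 1; ring
      · rw [← hZ (-π - η)]; congr 1; ring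
    simp only [u, (e hX.periodic).1, (e hX.periodic).2, (e hY.periodic).1, (e hY.periodic).2]
  have hc1 : Continuous fun γ => inner ℝ (X γ - X (γ - η) - (Y γ - Y (γ - η)))
      (velocityKernel X γ η - velocityKernel Y γ η) := by
    have hk1 : Continuous fun γ => ‖X γ - X (γ - η)‖⁻¹ := Continuous.inv₀ (by fun_prop) hk
    have hk2 : Continuous fun γ => ‖Y γ - Y (γ - η)‖⁻¹ := Continuous.inv₀ (by fun_prop) hkY
    unfold velocityKernel
    fun_prop
  have hc2 : Continuous fun γ => ‖X γ - X (γ - η) - (Y γ - Y (γ - η))‖ ^ 2 / η := by fun_prop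
  calc _ ≤ ∫ γ in (-π)..π, (1 / 2 * u' γ +
        3 / 2 * M ^ 3 * (‖X γ - X (γ - η) - (Y γ - Y (γ - η))‖ ^ 2 / η)) := by
        refine intervalIntegral.integral_mono (by linarith) (hc1.intervalIntegrable _ _)
          (((hu'c.const_mul _).add (hc2.const_mul _)).intervalIntegrable _ _) fun γ => ?_
        exact inner_sub_kernel_le hη (hchX γ) (hchY γ) (hdX γ) (hdY γ)
    _ = _ := by
        rw [intervalIntegral.integral_add ((hu'c.const_mul _).intervalIntegrable _ _)
          ((hc2.const_mul _).intervalIntegrable _ _), intervalIntegral.integral_const_mul,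
          intervalIntegral.integral_const_mul, hu0, mul_zero, zero_add]

theorem BddC11.integral_norm_sub_sq_div_le (hX : BddC11 M X) (hY : BddC11 M Y) {η ε : ℝ}
    (hη : 0 < η) (hε : 0 < ε) :
    ∫ γ in (-π)..π, ‖X γ - X (γ - η) - (Y γ - Y (γ - η))‖ ^ 2 / η ≤
      8 * (M + 1) * ((∫ γ in (-π)..π, ‖X γ - Y γ‖ ^ 2) + ε ^ 2) / (η + ε) := by
  have hpi := Real.pi_pos
  have hM := hX.nonneg
  have cX := hX.differentiable.continuous
  have cY := hY.differentiable.continuous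
  have hz : Continuous fun γ => ‖X γ - Y γ‖ ^ 2 := by fun_prop
  have hzη : Continuous fun γ => ‖X (γ - η) - Y (γ - η)‖ ^ 2 := by fun_prop
  have hper : Function.Periodic (fun γ => ‖X γ - Y γ‖ ^ 2) (2 * π) := fun γ => by
    simp only [hX.periodic γ, hY.periodic γ]
  have hc2 : Continuous fun γ => ‖X γ - X (γ - η) - (Y γ - Y (γ - η))‖ ^ 2 / η := by fun_prop
  have hE0 : 0 ≤ ∫ γ in (-π)..π, ‖X γ - Y γ‖ ^ 2 :=
    intervalIntegral.integral_nonneg (by linarith) fun γ _ => sq_nonneg _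
  calc _ ≤ ∫ γ in (-π)..π, (M + 1) / (η + ε) *
        ((2 * ‖X γ - Y γ‖ ^ 2 + 2 * ‖X (γ - η) - Y (γ - η)‖ ^ 2) + ε ^ 2) := by
        refine intervalIntegral.integral_mono (by linarith) (hc2.intervalIntegrable _ _)
          (Continuous.intervalIntegrable (by fun_prop) _ _) fun γ => ?_
        set w := ‖X γ - X (γ - η) - (Y γ - Y (γ - η))‖
        have hw : w ≤ 2 * M * η := by
          refine (_root_.norm_sub_le _ _).trans ?_
          have h1 := hX.norm_sub_le γ (γ - η)
          have h2 := hY.norm_sub_le γ (γ - η)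
          rw [sub_sub_cancel, abs_of_pos hη] at h1 h2
          linarith
        have hw2 : w ^ 2 ≤ 2 * ‖X γ - Y γ‖ ^ 2 + 2 * ‖X (γ - η) - Y (γ - η)‖ ^ 2 := by
          have : w ≤ ‖X γ - Y γ‖ + ‖X (γ - η) - Y (γ - η)‖ := by
            simp only [w]
            rw [sub_sub_sub_comm]
            exact _root_.norm_sub_le _ _
          have h0 : 0 ≤ w := norm_nonneg _
          nlinarith [sq_nonneg (‖X γ - Y γ‖ - ‖X (γ - η) - Y (γ - η)‖)]
        refine (sq_div_le_div_add hη hε hM (norm_nonneg _) hw).trans ?_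
        rw [mul_div_right_comm]
        gcongr
    _ = (M + 1) / (η + ε) * (4 * (∫ γ in (-π)..π, ‖X γ - Y γ‖ ^ 2) + 2 * π * ε ^ 2) := by
        have hs : Continuous fun γ => 2 * ‖X γ - Y γ‖ ^ 2 + 2 * ‖X (γ - η) - Y (γ - η)‖ ^ 2 :=
          (hz.const_mul 2).add (hzη.const_mul 2)
        rw [intervalIntegral.integral_const_mul, intervalIntegral.integral_add
          (hs.intervalIntegrable _ _)
          (continuous_const.intervalIntegrable _ _), intervalIntegral.integral_add
          ((hz.const_mul 2).intervalIntegrable _ _) ((hzη.const_mul 2).intervalIntegrable _ _),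
          intervalIntegral.integral_const_mul, intervalIntegral.integral_const_mul,
          intervalIntegral_comp_sub_of_periodic hper η, intervalIntegral.integral_const,
          smul_eq_mul]
        ring
    _ ≤ (M + 1) / (η + ε) * (8 * ((∫ γ in (-π)..π, ‖X γ - Y γ‖ ^ 2) + ε ^ 2)) := by
        gcongr
        nlinarith [Real.pi_le_four, sq_nonneg ε]
    _ = _ := by ring

theorem integral_inv_add {ε : ℝ} (hε : 0 < ε) :
    ∫ η in (0)..π, (η + ε)⁻¹ = Real.log ((π + ε) / ε) := by
  rw [intervalIntegral.integral_comp_add_right (fun η => η⁻¹), zero_add,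
    integral_inv_of_pos hε (by positivity)]

/-- The energy inequality, with a logarithmic loss in the free parameter `ε`. -/
theorem Admissible.integral_inner_velocity_sub_le (hX : Admissible M X) (hY : Admissible M Y)
    {ε : ℝ} (hε : 0 < ε) :
    ∫ γ in (-π)..π, inner ℝ (X γ - Y γ) (velocity X γ - velocity Y γ) ≤
      12 * M ^ 3 * (M + 1) * Real.log ((π + ε) / ε) *
        ((∫ γ in (-π)..π, ‖X γ - Y γ‖ ^ 2) + ε ^ 2) := by
  have hpi := Real.pi_pos
  have hM := hX.toBddC11.nonneg
  set E := ∫ γ in (-π)..π, ‖X γ - Y γ‖ ^ 2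
  have hE0 : 0 ≤ E :=
    intervalIntegral.integral_nonneg (by linarith) fun γ _ => sq_nonneg _
  obtain ⟨hR, heq⟩ := hX.integral_inner_velocity_sub hY
  have hlog : ∫ η in (0)..π, 12 * M ^ 3 * (M + 1) * (E + ε ^ 2) * (η + ε)⁻¹ =
      12 * M ^ 3 * (M + 1) * Real.log ((π + ε) / ε) * (E + ε ^ 2) := by
    rw [intervalIntegral.integral_const_mul, integral_inv_add hε]; ring
  have hint : IntervalIntegrable (fun η => 12 * M ^ 3 * (M + 1) * (E + ε ^ 2) * (η + ε)⁻¹)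
      volume 0 π := by
    refine ContinuousOn.intervalIntegrable (continuousOn_const.mul (ContinuousOn.inv₀
      (by fun_prop) fun η hη => ?_))
    rw [uIcc_of_le hpi.le] at hη
    linarith [hη.1]
  rw [heq, ← hlog]
  -- The comparison is made on the open interval because the chords vanish at `η = 0`. The constant
  -- is `12 = 3/2 · 8`.
  refine intervalIntegral.integral_mono_on_of_le_Ioo hpi.le hR hint fun η hη => ?_
  have hchord : ∀ {Z : ℝ → Plane}, Admissible M Z → ∀ γ, Z γ - Z (γ - η) ≠ 0 := by
    intro Z hZ γ h
    have := hZ.chord γ η (by rw [abs_of_pos hη.1]; exact hη.2.le)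
    rw [h, norm_zero, mul_zero, abs_of_pos hη.1] at this
    linarith [hη.1]
  rw [hX.toBddC11.integral_energyKernel_add_neg hY.toBddC11 (hchord hX) (hchord hY)]
  refine (hX.integral_inner_velocityKernel_sub_le hY hη.1 hη.2.le).trans ?_
  calc _ ≤ 3 / 2 * M ^ 3 * (8 * (M + 1) * (E + ε ^ 2) / (η + ε)) := by
        gcongr
        exact hX.toBddC11.integral_norm_sub_sq_div_le hY.toBddC11 hη.1 hε
    _ = _ := by ring

end

/-! ### Evolution of the energy and logarithmic Gronwall -/

/-- The squared `L²` distance of `x t` and `y t`. -/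
noncomputable def energy (x y : ℝ → ℝ → Plane) (t : ℝ) : ℝ :=
  ∫ γ in (-π)..π, ‖x t γ - y t γ‖ ^ 2

theorem energy_nonneg (x y : ℝ → ℝ → Plane) (t : ℝ) : 0 ≤ energy x y t :=
  intervalIntegral.integral_nonneg (by linarith [Real.pi_pos]) fun _ _ => sq_nonneg _

/-- A logarithmic Gronwall inequality, uniform in the parameter `ε`, forces `E` to vanish for a
time depending only on `K`. -/
theorem eq_zero_of_log_gronwall {K a b : ℝ} (hK : 0 < K) (hba : b - a ≤ 1 / K) {E E' : ℝ → ℝ}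
    (hE : ContinuousOn E (Icc a b)) (hd : ∀ t ∈ Ioo a b, HasDerivAt E (E' t) t)
    (hE' : ∀ t ∈ Ioo a b, ∀ ε > 0, E' t ≤ K * Real.log ((π + ε) / ε) * (E t + ε ^ 2))
    (hnn : ∀ t, 0 ≤ E t) (ha : E a = 0) : ∀ t ∈ Icc a b, E t = 0 := by
  intro t ht
  have hpi := Real.pi_pos
  have key : ∀ ε : ℝ, 0 < ε → E t ≤ (π + ε) * ε := by
    intro ε hε
    set L := Real.log ((π + ε) / ε) with hL
    have hL0 : 0 ≤ L := Real.log_nonneg (by rw [one_le_div hε]; linarith)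
    -- Gronwall for `E + ε²`, with the integrating factor for the rate `K * L`.
    have hanti : AntitoneOn (fun s => (E s + ε ^ 2) * Real.exp (-(K * L * (s - a)))) (Icc a b) := by
      have hexp : ∀ s, HasDerivAt (fun s => Real.exp (-(K * L * (s - a))))
          (Real.exp (-(K * L * (s - a))) * (-(K * L))) s := by
        intro s
        have h := (((hasDerivAt_id s).sub_const a).const_mul (K * L)).neg.exp
        simpa using h
      have hder : ∀ s ∈ Ioo a b, HasDerivAt
          (fun s => (E s + ε ^ 2) * Real.exp (-(K * L * (s - a))))
          (E' s * Real.exp (-(K * L * (s - a))) +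
            (E s + ε ^ 2) * (Real.exp (-(K * L * (s - a))) * (-(K * L)))) s := fun s hs =>
        ((hd s hs).add_const _).mul (hexp s)
      refine antitoneOn_of_deriv_nonpos (convex_Icc a b)
        ((hE.add continuousOn_const).mul (by fun_prop)) ?_ ?_
      · rw [interior_Icc]
        exact fun s hs => (hder s hs).differentiableAt.differentiableWithinAt
      · rw [interior_Icc]
        intro s hs
        rw [(hder s hs).deriv]
        have h1 := hE' s hs ε hε
        have h2 := Real.exp_pos (-(K * L * (s - a)))
        nlinarith
    have h1 := hanti (left_mem_Icc.2 (ht.1.trans ht.2)) ht ht.1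
    simp only [sub_self, mul_zero, neg_zero, Real.exp_zero, mul_one, ha, zero_add] at h1
    have h2 : E t + ε ^ 2 ≤ ε ^ 2 * Real.exp (K * L * (t - a)) := by
      rw [Real.exp_neg, ← div_eq_mul_inv, div_le_iff₀ (Real.exp_pos _)] at h1
      exact h1
    -- The time restriction makes the growth factor at most `exp L = (π + ε) / ε`, which costs only
    -- one of the two powers of `ε`.
    have h3 : K * L * (t - a) ≤ L := by
      have : K * (t - a) ≤ 1 := by
        have := mul_le_mul_of_nonneg_left ((sub_le_sub_right ht.2 a).trans hba) hK.le
        rwa [mul_one_div_cancel hK.ne'] at this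
      nlinarith
    have h4 : Real.exp L = (π + ε) / ε := Real.exp_log (by positivity)
    have h5 : ε ^ 2 * Real.exp (K * L * (t - a)) ≤ ε ^ 2 * ((π + ε) / ε) := by
      rw [← h4]; gcongr
    have h6 : ε ^ 2 * ((π + ε) / ε) = (π + ε) * ε := by field_simp
    nlinarith [sq_nonneg ε]
  refine le_antisymm ?_ (hnn t)
  have hlim : Tendsto (fun ε : ℝ => (π + ε) * ε) (𝓝[>] 0) (𝓝 0) := by
    have : Continuous fun ε : ℝ => (π + ε) * ε := by fun_prop
    simpa using (this.tendsto 0).mono_left nhdsWithin_le_nhds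
  exact ge_of_tendsto hlim (eventually_mem_nhdsWithin.mono fun ε hε => key ε hε)

section
variable {T M : ℝ} {x y : ℝ → ℝ → Plane}

/-- The equation holds only for `0 < t < T`; continuity carries the initial condition to the
endpoint. -/
theorem continuousOn_energy (hx : IsSolution T x) (hy : IsSolution T y)
    (hMx : ∀ t ∈ Icc 0 T, Admissible M (x t)) (hMy : ∀ t ∈ Icc 0 T, Admissible M (y t)) :
    ContinuousOn (energy x y) (Icc 0 T) := by
  intro t₀ ht₀
  refine intervalIntegral.continuousWithinAt_of_dominated_interval (bound := fun _ => (2 * M) ^ 2)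
    ?_ ?_ intervalIntegrable_const ?_
  · filter_upwards [self_mem_nhdsWithin] with t ht
    have h1 := (hMx t ht).differentiable.continuous
    have h2 := (hMy t ht).differentiable.continuous
    exact (by fun_prop : Continuous fun γ => ‖x t γ - y t γ‖ ^ 2).aestronglyMeasurable
  · filter_upwards [self_mem_nhdsWithin] with t ht
    refine ae_of_all _ fun γ _ => ?_
    rw [norm_pow, norm_norm]
    gcongr
    refine (norm_sub_le _ _).trans ?_
    linarith [(hMx t ht).norm_le γ, (hMy t ht).norm_le γ]
  · exact ae_of_all _ fun γ _ =>
      ((hx.continuousOn γ t₀ ht₀).sub (hy.continuousOn γ t₀ ht₀)).norm.pow 2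

theorem hasDerivAt_energy (hx : IsSolution T x) (hy : IsSolution T y)
    (hMx : ∀ t ∈ Icc 0 T, Admissible M (x t)) (hMy : ∀ t ∈ Icc 0 T, Admissible M (y t))
    {t : ℝ} (ht : t ∈ Ioo 0 T) :
    HasDerivAt (energy x y) (2 * ∫ γ in (-π)..π,
      inner ℝ (x t γ - y t γ) (velocity (x t) γ - velocity (y t) γ)) t := by
  have hIcc : ∀ {s}, s ∈ Ioo 0 T → s ∈ Icc 0 T := fun h => Ioo_subset_Icc_self h
  have hM := (hMx t (hIcc ht)).toBddC11.nonneg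
  have hcont : ∀ s ∈ Ioo 0 T, Continuous fun γ => ‖x s γ - y s γ‖ ^ 2 := by
    intro s hs
    have h1 := (hMx s (hIcc hs)).differentiable.continuous
    have h2 := (hMy s (hIcc hs)).differentiable.continuous
    fun_prop
  have h := intervalIntegral.hasDerivAt_integral_of_dominated_loc_of_deriv_le
    (a := -π) (b := π) (μ := volume) (𝕜 := ℝ)
    (F := fun t γ => ‖x t γ - y t γ‖ ^ 2)
    (F' := fun t γ => 2 * inner ℝ (x t γ - y t γ) (velocity (x t) γ - velocity (y t) γ))
    (x₀ := t) (s := Ioo 0 T) (bound := fun _ => 2 * (2 * M * (2 * (M ^ 2 * (2 * π)))))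
    (isOpen_Ioo.mem_nhds ht) ?_ ((hcont t ht).intervalIntegrable _ _) ?_ ?_
    intervalIntegrable_const ?_
  · rw [← intervalIntegral.integral_const_mul]
    exact h.2
  · filter_upwards [isOpen_Ioo.mem_nhds ht] with s hs
    exact (hcont s hs).aestronglyMeasurable
  · have h1 := (hMx t (hIcc ht)).differentiable.continuous.stronglyMeasurable
    have h2 := (hMy t (hIcc ht)).differentiable.continuous.stronglyMeasurable
    have h3 := (hMx t (hIcc ht)).toBddC11.stronglyMeasurable_velocity
    have h4 := (hMy t (hIcc ht)).toBddC11.stronglyMeasurable_velocity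
    exact (((h1.sub h2).inner (h3.sub h4)).const_mul 2).aestronglyMeasurable
  · refine ae_of_all _ fun γ _ s hs => ?_
    rw [norm_mul, Real.norm_two]
    gcongr
    refine (norm_inner_le_norm _ _).trans ?_
    gcongr
    · refine (norm_sub_le _ _).trans ?_
      linarith [(hMx s (hIcc hs)).norm_le γ, (hMy s (hIcc hs)).norm_le γ]
    · refine (norm_sub_le _ _).trans ?_
      linarith [(hMx s (hIcc hs)).norm_velocity_le γ, (hMy s (hIcc hs)).norm_velocity_le γ]
  · exact ae_of_all _ fun γ _ s hs => ((hx.equation s hs γ).sub (hy.equation s hs γ)).norm_sq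

theorem eq_of_energy_eq_zero {t : ℝ} (hX : Admissible M (x t)) (hY : Admissible M (y t))
    (h : energy x y t = 0) : x t = y t := by
  have hpi := Real.pi_pos
  have h1 := hX.differentiable.continuous
  have h2 := hY.differentiable.continuous
  have hc : Continuous fun γ => ‖x t γ - y t γ‖ ^ 2 := by fun_prop
  have hper : Function.Periodic (fun γ => ‖x t γ - y t γ‖ ^ 2) (2 * π) := fun γ => by
    simp only [hX.periodic γ, hY.periodic γ]
  have hne : ∀ γ ∈ Icc (-π) π, ‖x t γ - y t γ‖ ^ 2 = 0 := by
    by_contra! hcon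
    obtain ⟨γ, hγ, hγ0⟩ := hcon
    have := intervalIntegral.integral_pos (by linarith : -π < π) hc.continuousOn
      (fun _ _ => sq_nonneg _) ⟨γ, hγ, lt_of_le_of_ne (sq_nonneg _) hγ0.symm⟩
    exact this.ne' h
  ext1 γ
  obtain ⟨γ', hγ', he⟩ := hper.exists_mem_Ico (by linarith) γ (-π)
  have h0 := hne γ' ⟨hγ'.1, by linarith [hγ'.2]⟩
  rw [← he] at h0
  exact sub_eq_zero.1 (norm_eq_zero.1 (pow_eq_zero_iff two_ne_zero |>.1 h0))

end

end SQGContour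

theorem mainTheorem3 (T : ℝ) (hT : 0 < T) (x y : ℝ → ℝ → SQGContour.Plane)
    (hx : SQGContour.IsSolution T x) (hy : SQGContour.IsSolution T y)
    (h0 : x 0 = y 0) :
    ∀ t ∈ Set.Icc 0 T, x t = y t := by
  obtain ⟨M₁, hM₁⟩ := hx.exists_admissible
  obtain ⟨M₂, hM₂⟩ := hy.exists_admissible
  set M := max 1 (max M₁ M₂)
  have hM : 1 ≤ M := le_max_left _ _
  have hMx : ∀ t ∈ Icc 0 T, SQGContour.Admissible M (x t) := fun t ht =>
    (hM₁ t ht).mono ((le_max_left _ _).trans (le_max_right _ _))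
  have hMy : ∀ t ∈ Icc 0 T, SQGContour.Admissible M (y t) := fun t ht =>
    (hM₂ t ht).mono ((le_max_right _ _).trans (le_max_right _ _))
  -- Twice the constant `12 * M ^ 3 * (M + 1)`, since the energy is not halved; `1 ≤ M` makes it
  -- positive.
  set K := 24 * M ^ 3 * (M + 1)
  have hK : 0 < K := by positivity
  have hcont := SQGContour.continuousOn_energy hx hy hMx hMy
  -- The vanishing time `1 / K` does not depend on the starting time, so the argument restarts at
  -- each multiple of it.
  have hstep : ∀ n : ℕ, ∀ t ∈ Icc 0 T, t ≤ n * (1 / K) → SQGContour.energy x y t = 0 := by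
    intro n
    induction n with
    | zero =>
      intro t ht htn
      have : t = 0 := le_antisymm (by simpa using htn) ht.1
      simp [this, SQGContour.energy, h0]
    | succ n ih =>
      intro t ht htn
      rcases le_total t (n * (1 / K)) with hle | hle
      · exact ih t ht hle
      have hn0 : 0 ≤ n * (1 / K) := by positivity
      refine SQGContour.eq_zero_of_log_gronwall (a := n * (1 / K)) (b := t) hK
        (by push_cast at htn; linarith) (hcont.mono (Icc_subset_Icc hn0 ht.2))
        (fun s hs => SQGContour.hasDerivAt_energy hx hy hMx hMy
          ⟨hn0.trans_lt hs.1, hs.2.trans_le ht.2⟩)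
        (fun s hs ε hε => ?_) (SQGContour.energy_nonneg x y)
        (ih _ ⟨hn0, hle.trans ht.2⟩ le_rfl) t (right_mem_Icc.2 hle)
      have hs' : s ∈ Icc 0 T := ⟨hn0.trans hs.1.le, hs.2.le.trans ht.2⟩
      have := (hMx s hs').integral_inner_velocity_sub_le (hMy s hs') hε
      calc _ ≤ 2 * _ := mul_le_mul_of_nonneg_left this zero_le_two
        _ = _ := by simp only [K, SQGContour.energy]; ring
  intro t ht
  obtain ⟨n, hn⟩ := exists_nat_ge (t / (1 / K))
  exact SQGContour.eq_of_energy_eq_zero (hMx t ht) (hMy t ht)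
    (hstep n t ht ((div_le_iff₀ (by positivity)).1 hn))
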